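/- There is a universal constant $c>0$ such that for every number of arms $K\ge 2$ and every horizon $T$ with $T\ge\sqrt{KT}$ there is a probability distribution $D$ on the reward assignments $\mathbf x=(x_i(t))_{1\le t\le T,\,1\le i\le K}\in[0,1]^{T\times K}$ with the following property. Let $\psi:\mathbb R\to\mathbb R$ be any non-decreasing function with $\psi(0)=0$ (for instance the identity), and consider any, possibly randomized, utility-based dueling bandit algorithm: in each round $t$ it pulls a pair of arms $(a_t,b_t)\in\{1,\dots,K\}^2$, chosen on the basis of its internal randomness (independent of $\mathbf x$) and of the pairs and feedbacks of the earlier rounds only, and then observes only the relative feedback $\psi\big(x_{a_t}(t)-x_{b_t}(t)\big)$. When the rewards are drawn from $D$, its expected cumulative regret satisfies $$\mathbb E\Big[\max_{1\le i\le K}\sum_{t=1}^T x_i(t)\;-\;\frac12\sum_{t=1}^T\big(x_{a_t}(t)+x_{b_t}(t)\big)\Big]\;\ge\; c\,\sqrt{KT},$$ where the expectation is over the rewards and the internal randomness of the algorithm. -/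

import Mathlib

open MeasureTheory

universe u

noncomputable section

namespace DuelingBandit

/-- What the learner sees in one round: the pair of arms it pulled and the relative feedback. -/
abbrev Observation (K : ℕ) : Type := (Fin K × Fin K) × ℝ

/-- An assignment of rewards: the utility `x t i ∈ [0,1]` of every arm `i` in every round `t`
(rounds are numbered `0, …, T - 1`). -/
abbrev RewardAssignment (K T : ℕ) : Type := Fin T → Fin K → unitInterval

/-- A randomized dueling bandit algorithm with `K` arms whose internal randomness is a seed
`ω : Ω`. In round `t` it pulls a pair of arms that depends on the seed and on the `t` observations
made before that round, and on nothing else. -/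
structure Algorithm (K : ℕ) (Ω : Type*) [MeasurableSpace Ω] where
  /-- the pair pulled in round `t`, given the seed and the past observations -/
  act : (t : ℕ) → Ω → (Fin t → Observation K) → Fin K × Fin K
  measurable_act : ∀ t : ℕ,
    Measurable (fun p : Ω × (Fin t → Observation K) => act t p.1 p.2)

variable {K T : ℕ} {Ω : Type*} [MeasurableSpace Ω]

/-- The first `t` observations when `A` plays with seed `ω` on the rewards `x`: pulling `(a, b)`
in round `s` reveals `ψ (x_a(s) - x_b(s))` and nothing else about the rewards. -/
def history (ψ : ℝ → ℝ) (A : Algorithm K Ω) (x : RewardAssignment K T) (ω : Ω) :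
    (t : ℕ) → t ≤ T → (Fin t → Observation K)
  | 0, _ => Fin.elim0
  | t + 1, h =>
    let past := history ψ A x ω t (Nat.le_of_succ_le h)
    let ab := A.act t ω past
    Fin.snoc (α := fun _ => Observation K) past
      (ab, ψ ((x ⟨t, h⟩ ab.1 : ℝ) - (x ⟨t, h⟩ ab.2 : ℝ)))

/-- The pair of arms pulled by `A` in round `t`. -/
def pull (ψ : ℝ → ℝ) (A : Algorithm K Ω) (x : RewardAssignment K T) (ω : Ω) (t : Fin T) :
    Fin K × Fin K :=
  A.act t ω (history ψ A x ω t t.isLt.le)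

/-- The gain of the algorithm, `½ ∑ₜ (x_a(t) + x_b(t))` with `(a, b)` the pair pulled in
round `t`. -/
def algGain (ψ : ℝ → ℝ) (A : Algorithm K Ω) (x : RewardAssignment K T) (ω : Ω) : ℝ :=
  (1 / 2) * ∑ t : Fin T,
    ((x t (pull ψ A x ω t).1 : ℝ) + (x t (pull ψ A x ω t).2 : ℝ))

/-- The gain of the best single arm, `maxᵢ ∑ₜ xᵢ(t)`. -/
def maxGain (x : RewardAssignment K T) : ℝ :=
  ⨆ i : Fin K, ∑ t : Fin T, (x t i : ℝ)

/-- The expected cumulative regret `E[G_max - G_alg]`, the rewards being drawn from `D` and,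
independently of them, the seed of the algorithm from `μ`. -/
def expectedRegret (ψ : ℝ → ℝ) (A : Algorithm K Ω) (μ : Measure Ω)
    (D : Measure (RewardAssignment K T)) : ℝ :=
  ∫ p : RewardAssignment K T × Ω, (maxGain p.1 - algGain ψ A p.1 p.2) ∂(D.prod μ)

end DuelingBandit

end

/-! Hide one good arm. All rewards are fair bits, except that a uniformly random arm `i` has mean
sign `δ`, of order `√(K / T)`. The feedback is a function of the two pulled rewards, so it suffices
to bound learners that see both, whatever `ψ` is; fixing the seed makes every expectation a weighted
sum over bit arrays.

Bits of the current round are independent of the pulled pair, so arm `i` gains `δ (T - E_i[N_i])` in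
signs over the learner, `N_i` being `pullCount` (`sum_biasedWeight_mul_advantage`). To bound
`E_i[N_i]`, compare with all bits fair. Only observed bits of arm `i` matter for the likelihood
ratio (`sum_biasedWeight_mul_eq`), and its relative entropy is at most `2 δ² E_0[N_i]`
(`sum_log_observedWeight`). A Pinsker-type inequality then bounds `E_i[N_i] - E_0[N_i]`. Since the
`E_0[N_i]` add up to `T`, the average of `E_i[N_i]` over `i` is at most `3T/4`. -/

namespace DuelingBandit

/-! ### Bit flips on the cube of bit arrays -/

/-- The sign `±1` of a bit. -/
noncomputable def bitSign (b : Bool) : ℝ := if b then 1 else -1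

@[simp] lemma bitSign_not (b : Bool) : bitSign (!b) = -bitSign b := by
  cases b <;> simp [bitSign]

lemma bitSign_mul_self (b : Bool) : bitSign b * bitSign b = 1 := by
  cases b <;> simp [bitSign]

/-- Flip the bit of arm `i` in round `t`. -/
def flipBit {K T : ℕ} (t : Fin T) (i : Fin K) (x : Fin T → Fin K → Bool) :
    Fin T → Fin K → Bool :=
  Function.update x t (Function.update (x t) i (!x t i))

section Flip

variable {K T : ℕ} (t : Fin T) (i : Fin K) (x : Fin T → Fin K → Bool)

@[simp] lemma flipBit_same : flipBit t i x t i = !x t i := by simp [flipBit]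

lemma flipBit_of_ne_round {s : Fin T} (h : s ≠ t) : flipBit t i x s = x s := by
  simp [flipBit, h]

lemma flipBit_of_ne_arm (s : Fin T) {j : Fin K} (h : j ≠ i) : flipBit t i x s j = x s j := by
  by_cases hs : s = t
  · subst hs; simp [flipBit, h]
  · rw [flipBit_of_ne_round t i x hs]

lemma flipBit_involutive : Function.Involutive (flipBit t i) := by
  intro x
  funext s j
  by_cases hj : j = i
  · subst hj
    by_cases hs : s = t
    · subst hs; simp
    · rw [flipBit_of_ne_round _ _ _ hs, flipBit_of_ne_round _ _ _ hs]
  · rw [flipBit_of_ne_arm _ _ _ _ hj, flipBit_of_ne_arm _ _ _ _ hj]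

lemma sum_comp_flipBit (g : (Fin T → Fin K → Bool) → ℝ) :
    ∑ x, g (flipBit t i x) = ∑ x, g x :=
  Equiv.sum_comp (flipBit_involutive t i).toPerm g

lemma sum_eq_zero_of_flipBit_neg {g : (Fin T → Fin K → Bool) → ℝ}
    (h : ∀ x, g (flipBit t i x) = -g x) : ∑ x, g x = 0 := by
  have := sum_comp_flipBit t i g
  simp only [h, Finset.sum_neg_distrib] at this
  linarith

end Flip

/-! ### Biased densities and the likelihood of observed bits -/

/-- The density, with respect to fair bits, of bits that are independent and fair except that
those of arm `i` have mean sign `δ`. -/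
noncomputable def biasedWeight {K T : ℕ} (δ : ℝ) (i : Fin K) (x : Fin T → Fin K → Bool) : ℝ :=
  ∏ t, (1 + δ * bitSign (x t i))

section Weight

variable {K T : ℕ} {δ : ℝ} {i : Fin K}

lemma one_add_mul_bitSign_pos (h0 : 0 ≤ δ) (h1 : δ < 1) (b : Bool) : 0 < 1 + δ * bitSign b := by
  cases b <;> simp [bitSign] <;> linarith

lemma biasedWeight_nonneg (h0 : 0 ≤ δ) (h1 : δ < 1) (x : Fin T → Fin K → Bool) :
    0 ≤ biasedWeight δ i x :=
  Finset.prod_nonneg fun _ _ => (one_add_mul_bitSign_pos h0 h1 _).le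

lemma sum_biasedWeight_mul_bitSign_sub (t : Fin T) {f : (Fin T → Fin K → Bool) → ℝ}
    (hf : ∀ x, f (flipBit t i x) = f x) :
    ∑ x, biasedWeight δ i x * ((bitSign (x t i) - δ) * f x) = 0 := by
  -- With `s = ±1`, `(1 + δ s)(s - δ) = (1 - δ²) s`, which is odd under the flip.
  have h : ∀ x : Fin T → Fin K → Bool, biasedWeight δ i x * ((bitSign (x t i) - δ) * f x) =
      (1 - δ ^ 2) * (bitSign (x t i) * f x *
        ∏ s ∈ Finset.univ.erase t, (1 + δ * bitSign (x s i))) := by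
    intro x
    rw [biasedWeight, ← Finset.mul_prod_erase _ _ (Finset.mem_univ t)]
    linear_combination (δ * f x * ∏ s ∈ Finset.univ.erase t, (1 + δ * bitSign (x s i))) *
      bitSign_mul_self (x t i)
  simp only [h, ← Finset.mul_sum]
  rw [sum_eq_zero_of_flipBit_neg t i, mul_zero]
  intro x
  have : ∏ s ∈ Finset.univ.erase t, (1 + δ * bitSign (flipBit t i x s i)) =
      ∏ s ∈ Finset.univ.erase t, (1 + δ * bitSign (x s i)) :=
    Finset.prod_congr rfl fun s hs => by
      rw [flipBit_of_ne_round t i x (Finset.ne_of_mem_erase hs)]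
  rw [this, hf]
  simp

lemma sum_biasedWeight_mul_bitSign_of_ne (t : Fin T) {j : Fin K} (hj : j ≠ i)
    {f : (Fin T → Fin K → Bool) → ℝ} (hf : ∀ x, f (flipBit t j x) = f x) :
    ∑ x, biasedWeight δ i x * (bitSign (x t j) * f x) = 0 := by
  apply sum_eq_zero_of_flipBit_neg t j
  intro x
  have : biasedWeight δ i (flipBit t j x) = biasedWeight δ i x :=
    Finset.prod_congr rfl fun s _ => by rw [flipBit_of_ne_arm t j x s hj.symm]
  rw [this, hf]
  simp

/-- Under the biased weight, an arm that is chosen before the bits of round `t` are revealed has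
mean sign `δ` when it is the arm `i`, and `0` otherwise. -/
lemma sum_biasedWeight_mul_bitSign_choice (t : Fin T) {q : (Fin T → Fin K → Bool) → Fin K}
    (hq : ∀ j x, q (flipBit t j x) = q x) :
    ∑ x, biasedWeight δ i x * bitSign (x t (q x)) =
      δ * ∑ x, biasedWeight δ i x * (if q x = i then 1 else 0) := by
  have h : ∀ x : Fin T → Fin K → Bool, biasedWeight δ i x * bitSign (x t (q x)) =
      ∑ j, biasedWeight δ i x * (bitSign (x t j) * (if q x = j then 1 else 0)) := by
    intro x
    rw [← Finset.mul_sum]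
    simp
  simp only [h]
  rw [Finset.sum_comm, Finset.sum_eq_single i]
  · have := sum_biasedWeight_mul_bitSign_sub (δ := δ) (i := i) t
      (f := fun x => if q x = i then 1 else 0) (fun x => by simp only [hq])
    rw [Finset.mul_sum, ← sub_eq_zero, ← Finset.sum_sub_distrib]
    exact (Finset.sum_congr rfl fun x _ => by ring).trans this
  · intro j _ hj
    exact sum_biasedWeight_mul_bitSign_of_ne t hj (fun x => by simp only [hq])
  · simp

/-- The density of the observed bits of arm `i`, where `e t x` tells whether its bit is observed
in round `t`. -/
noncomputable def observedWeight (δ : ℝ) (i : Fin K) (e : Fin T → (Fin T → Fin K → Bool) → Prop)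
    [∀ t x, Decidable (e t x)] (x : Fin T → Fin K → Bool) : ℝ :=
  ∏ t, (1 + if e t x then δ * bitSign (x t i) else 0)

/-- Unobserved bits can be integrated out. -/
lemma sum_biasedWeight_mul_eq (e : Fin T → (Fin T → Fin K → Bool) → Prop)
    [∀ t x, Decidable (e t x)] (f : (Fin T → Fin K → Bool) → ℝ)
    (he : ∀ t x, e t (flipBit t i x) ↔ e t x)
    (hne : ∀ t x, ¬ e t x → f (flipBit t i x) = f x ∧ ∀ s, e s (flipBit t i x) ↔ e s x) :
    ∑ x, biasedWeight δ i x * f x = ∑ x, observedWeight δ i e x * f x := by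
  -- Hybrid densities: unobserved factors are dropped only in rounds before `k`. Consecutive ones
  -- differ only where the bit of round `k` is unobserved, by a term odd in that bit.
  let H : ℕ → (Fin T → Fin K → Bool) → ℝ := fun k x =>
    ∏ t : Fin T, (1 + if (t : ℕ) < k → e t x then δ * bitSign (x t i) else 0)
  have key : ∀ k ≤ T, ∑ x, biasedWeight δ i x * f x = ∑ x, H k x * f x := by
    intro k
    induction k with
    | zero => intro _; simp [H, biasedWeight]
    | succ k ih =>
      intro hk
      rw [ih (Nat.le_of_succ_le hk), ← sub_eq_zero, ← Finset.sum_sub_distrib]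
      let u : Fin T := ⟨k, hk⟩
      have hsub : ∀ x, H k x * f x - H (k + 1) x * f x =
          (if e u x then 0 else δ * bitSign (x u i)) * f x * ∏ t ∈ Finset.univ.erase u,
            (1 + if (t : ℕ) < k → e t x then δ * bitSign (x t i) else 0) := by
        intro x
        have h2 : ∏ t ∈ Finset.univ.erase u,
              (1 + if (t : ℕ) < k + 1 → e t x then δ * bitSign (x t i) else 0) =
            ∏ t ∈ Finset.univ.erase u,
              (1 + if (t : ℕ) < k → e t x then δ * bitSign (x t i) else 0) := by
          refine Finset.prod_congr rfl fun t ht => ?_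
          have hne' : (t : ℕ) ≠ k := fun h => Finset.ne_of_mem_erase ht (Fin.ext h)
          have : (t : ℕ) < k + 1 ↔ (t : ℕ) < k := by omega
          simp only [this]
        simp only [H]
        rw [← Finset.mul_prod_erase _ _ (Finset.mem_univ u),
          ← Finset.mul_prod_erase (f := fun t : Fin T =>
            1 + if (t : ℕ) < k + 1 → e t x then δ * bitSign (x t i) else 0)
            (h := Finset.mem_univ u), h2]
        by_cases hu : e u x
        · simp [hu, u]
        · have hu' : ¬ e ⟨k, hk⟩ x := hu
          simp [hu', u]
          ring
      simp only [hsub]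
      apply sum_eq_zero_of_flipBit_neg u i
      intro x
      by_cases hu : e u x
      · simp [he, hu]
      · obtain ⟨hf, hs⟩ := hne u x hu
        have : ∏ t ∈ Finset.univ.erase u, (1 + if (t : ℕ) < k → e t (flipBit u i x) then
              δ * bitSign (flipBit u i x t i) else 0) =
            ∏ t ∈ Finset.univ.erase u,
              (1 + if (t : ℕ) < k → e t x then δ * bitSign (x t i) else 0) :=
          Finset.prod_congr rfl fun t ht => by
            rw [flipBit_of_ne_round u i x (Finset.ne_of_mem_erase ht)]
            simp only [hs]
        rw [this, hf]
        simp [he, hu]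
  rw [key T le_rfl]
  simp [H, observedWeight]

lemma sum_biasedWeight :
    ∑ x : Fin T → Fin K → Bool, biasedWeight δ i x = Fintype.card (Fin T → Fin K → Bool) := by
  have := sum_biasedWeight_mul_eq (δ := δ) (i := i) (T := T) (fun _ _ => False) (fun _ => 1)
    (by simp) (by simp)
  simpa [observedWeight] using this

/-- Pairing each array with its flip in round `t` preserves `e t`, and the two logarithms add up to
`log (1 - δ²)`. This computes the relative entropy, up to sign and normalisation. -/
lemma sum_log_observedWeight (h0 : 0 ≤ δ) (h1 : δ < 1)
    (e : Fin T → (Fin T → Fin K → Bool) → Prop) [∀ t x, Decidable (e t x)]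
    (he : ∀ t x, e t (flipBit t i x) ↔ e t x) :
    ∑ x, Real.log (observedWeight δ i e x) =
      (1 / 2) * Real.log (1 - δ ^ 2) * ∑ x, ∑ t, if e t x then 1 else 0 := by
  have hlog : ∀ x : Fin T → Fin K → Bool, Real.log (observedWeight δ i e x) =
      ∑ t, if e t x then Real.log (1 + δ * bitSign (x t i)) else 0 := by
    intro x
    rw [observedWeight, Real.log_prod]
    · refine Finset.sum_congr rfl fun t _ => ?_
      split_ifs <;> simp
    · intro t _
      split_ifs
      · exact (one_add_mul_bitSign_pos h0 h1 _).ne'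
      · simp
  have hpair : ∀ b : Bool, Real.log (1 + δ * bitSign b) + Real.log (1 + δ * bitSign (!b)) =
      Real.log (1 - δ ^ 2) := by
    intro b
    rw [← Real.log_mul (one_add_mul_bitSign_pos h0 h1 _).ne'
      (one_add_mul_bitSign_pos h0 h1 _).ne']
    congr 1
    rw [bitSign_not]
    linear_combination -δ ^ 2 * bitSign_mul_self b
  simp only [hlog]
  rw [Finset.sum_comm, Finset.sum_comm (f := fun x t => if e t x then (1 : ℝ) else 0),
    Finset.mul_sum]
  refine Finset.sum_congr rfl fun t _ => ?_
  have hflip := sum_comp_flipBit t i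
    (fun x => if e t x then Real.log (1 + δ * bitSign (x t i)) else 0)
  have hadd : (∑ x, if e t x then Real.log (1 + δ * bitSign (x t i)) else 0) +
      (∑ x, if e t (flipBit t i x) then
        Real.log (1 + δ * bitSign (flipBit t i x t i)) else 0) =
      Real.log (1 - δ ^ 2) * ∑ x, if e t x then 1 else 0 := by
    rw [← Finset.sum_add_distrib, Finset.mul_sum]
    refine Finset.sum_congr rfl fun x _ => ?_
    simp only [he, flipBit_same]
    split_ifs
    · rw [hpair, mul_one]
    · simp
  rw [hflip] at hadd
  linarith

end Weight

/-! ### Elementary inequalities for logarithms -/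

/-- A linearised form of Pinsker's inequality. -/
lemma abs_sub_one_le {L : ℝ} (hL : 0 < L) :
    |L - 1| ≤ 8 * (L - 1 - Real.log L) + (1 + L) / 16 := by
  -- With `L = r²`, `log r ≤ r - 1` gives `L - 1 - log L ≥ (r - 1)²`. Then `|r - 1| (r + 1) ≤ 8 (r -
  -- 1)² + (r + 1)² / 32` and `(r + 1)² ≤ 2 (1 + L)`.
  obtain ⟨r, hr, rfl⟩ : ∃ r : ℝ, 0 < r ∧ L = r ^ 2 :=
    ⟨√L, Real.sqrt_pos.2 hL, (Real.sq_sqrt hL.le).symm⟩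
  have hlog := Real.log_le_sub_one_of_pos hr
  rw [Real.log_pow, abs_le]
  push_cast
  constructor <;>
    nlinarith [sq_nonneg (16 * (r - 1) - (r + 1)), sq_nonneg (16 * (r - 1) + (r + 1)),
      sq_nonneg (r - 1)]

lemma neg_log_one_sub_sq_le {δ : ℝ} (h0 : 0 ≤ δ) (h1 : δ ≤ 1 / 2) :
    -Real.log (1 - δ ^ 2) ≤ 2 * δ ^ 2 := by
  have hpos : (0 : ℝ) < 1 - δ ^ 2 := by nlinarith
  have := Real.one_sub_inv_le_log_of_pos hpos
  have h2 : (1 - δ ^ 2)⁻¹ ≤ 1 + 2 * δ ^ 2 := by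
    rw [inv_le_iff_one_le_mul₀ hpos]
    nlinarith [sq_nonneg δ, mul_nonneg (sq_nonneg δ) (by nlinarith : 0 ≤ 1 - 2 * δ ^ 2)]
  linarith

/-! ### Regret of non-anticipating pulls -/

/-- Pairs of arms pulled without knowledge of unobserved bits: neither the bits of the current and
later rounds nor those of arms that were not pulled have any influence. -/
structure NonAnticipating {K T : ℕ} (p : Fin T → (Fin T → Fin K → Bool) → Fin K × Fin K) :
    Prop where
  past : ∀ t i x, ∀ s ≤ t, p s (flipBit t i x) = p s x
  unobserved : ∀ t i x, (p t x).1 ≠ i → (p t x).2 ≠ i → ∀ s, p s (flipBit t i x) = p s x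

/-- How often arm `i` is pulled, either place of a pair counting one half. -/
noncomputable def pullCount {K T : ℕ} (p : Fin T → (Fin T → Fin K → Bool) → Fin K × Fin K) (i : Fin K)
    (x : Fin T → Fin K → Bool) : ℝ :=
  ∑ t, ((if (p t x).1 = i then 1 else 0) + (if (p t x).2 = i then 1 else 0)) / 2

section Regret

variable {K T : ℕ} {δ : ℝ} {p : Fin T → (Fin T → Fin K → Bool) → Fin K × Fin K}

lemma pullCount_nonneg (i : Fin K) (x : Fin T → Fin K → Bool) : 0 ≤ pullCount p i x :=
  Finset.sum_nonneg fun t _ => by split_ifs <;> norm_num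

lemma pullCount_le (i : Fin K) (x : Fin T → Fin K → Bool) : pullCount p i x ≤ T := by
  have : pullCount p i x ≤ ∑ _t : Fin T, (1 : ℝ) :=
    Finset.sum_le_sum fun t _ => by split_ifs <;> norm_num
  simpa using this

lemma sum_pullCount (x : Fin T → Fin K → Bool) : ∑ i, pullCount p i x = T := by
  simp only [pullCount]
  rw [Finset.sum_comm]
  have : ∀ t, ∑ i, ((if (p t x).1 = i then (1 : ℝ) else 0) + (if (p t x).2 = i then 1 else 0)) / 2
      = 1 := by
    intro t
    rw [← Finset.sum_div, Finset.sum_add_distrib]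
    simp
  simp [this]

/-- The expected advantage of the biased arm over the pulled pairs. -/
lemma sum_biasedWeight_mul_advantage (hp : NonAnticipating p) (i : Fin K) :
    ∑ x, biasedWeight δ i x * (∑ t, bitSign (x t i) -
        (1 / 2) * ∑ t, (bitSign (x t (p t x).1) + bitSign (x t (p t x).2))) =
      δ * (T * Fintype.card (Fin T → Fin K → Bool) -
        ∑ x, biasedWeight δ i x * pullCount p i x) := by
  have hi : ∀ t : Fin T, ∑ x, biasedWeight δ i x * bitSign (x t i) =
      δ * Fintype.card (Fin T → Fin K → Bool) := by
    intro t
    have := sum_biasedWeight_mul_bitSign_choice (δ := δ) (i := i) t (q := fun _ => i) (by simp)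
    simpa [sum_biasedWeight] using this
  have h1 := fun t => sum_biasedWeight_mul_bitSign_choice (δ := δ) (i := i) t
    (q := fun x => (p t x).1) (fun j x => by simp only [hp.past t j x t le_rfl])
  have h2 := fun t => sum_biasedWeight_mul_bitSign_choice (δ := δ) (i := i) t
    (q := fun x => (p t x).2) (fun j x => by simp only [hp.past t j x t le_rfl])
  have hl : ∀ x : Fin T → Fin K → Bool, biasedWeight δ i x * (∑ t, bitSign (x t i) -
        (1 / 2) * ∑ t, (bitSign (x t (p t x).1) + bitSign (x t (p t x).2))) =
      ∑ t, (biasedWeight δ i x * bitSign (x t i) -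
        (1 / 2) * (biasedWeight δ i x * bitSign (x t (p t x).1) +
          biasedWeight δ i x * bitSign (x t (p t x).2))) := by
    intro x
    rw [Finset.sum_sub_distrib, ← Finset.mul_sum, ← Finset.mul_sum]
    simp only [← mul_add, ← Finset.mul_sum]
    ring
  have hr : ∀ x : Fin T → Fin K → Bool, biasedWeight δ i x * pullCount p i x =
      ∑ t, (1 / 2) * (biasedWeight δ i x * (if (p t x).1 = i then 1 else 0) +
        biasedWeight δ i x * (if (p t x).2 = i then 1 else 0)) := by
    intro x
    rw [pullCount, Finset.mul_sum]
    exact Finset.sum_congr rfl fun t _ => by ring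
  simp only [hl, hr]
  rw [Finset.sum_comm, Finset.sum_comm (γ := Fin T → Fin K → Bool)]
  simp only [Finset.sum_sub_distrib, ← Finset.mul_sum, Finset.sum_add_distrib, hi, h1, h2]
  simp
  ring

/-- Biasing arm `i` cannot make an algorithm pull it much more often. -/
lemma sum_biasedWeight_mul_pullCount_le (h0 : 0 ≤ δ) (h1 : δ ≤ 1 / 2) (hp : NonAnticipating p)
    (i : Fin K) :
    ∑ x, biasedWeight δ i x * pullCount p i x ≤
      ∑ x, pullCount p i x + T * (16 * δ ^ 2 * ∑ x, pullCount p i x +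
        Fintype.card (Fin T → Fin K → Bool) / 8) := by
  classical
  let e : Fin T → (Fin T → Fin K → Bool) → Prop := fun t x => (p t x).1 = i ∨ (p t x).2 = i
  have he : ∀ t x, e t (flipBit t i x) ↔ e t x := fun t x => by
    simp only [e, hp.past t i x t le_rfl]
  have hne : ∀ t x, ¬ e t x → ∀ s, p s (flipBit t i x) = p s x := fun t x h =>
    hp.unobserved t i x (fun h' => h (Or.inl h')) (fun h' => h (Or.inr h'))
  have hne' : ∀ t x, ¬ e t x → ∀ s, e s (flipBit t i x) ↔ e s x := fun t x h s => by
    simp only [e, hne t x h]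
  have hcount := sum_biasedWeight_mul_eq (δ := δ) e (pullCount p i) he
    (fun t x h => ⟨by simp only [pullCount, hne t x h], hne' t x h⟩)
  have hone := sum_biasedWeight_mul_eq (δ := δ) e (fun _ => 1) he
    (fun t x h => ⟨rfl, hne' t x h⟩)
  simp only [mul_one, sum_biasedWeight] at hone
  have hpos : ∀ x, 0 < observedWeight δ i e x := fun x => Finset.prod_pos fun t _ => by
    split_ifs
    · exact one_add_mul_bitSign_pos h0 (by linarith) _
    · simp
  have hlog := sum_log_observedWeight h0 (by linarith) e he
  -- The factor 2 covers rounds with arm `i` in one place only, which `pullCount` counts as one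
  -- half.
  have hobs : ∑ x, ∑ t, (if e t x then (1 : ℝ) else 0) ≤ 2 * ∑ x, pullCount p i x := by
    rw [Finset.mul_sum]
    refine Finset.sum_le_sum fun x _ => ?_
    rw [pullCount, Finset.mul_sum]
    refine Finset.sum_le_sum fun t _ => ?_
    by_cases ha : (p t x).1 = i <;> by_cases hb : (p t x).2 = i <;> simp [e, ha, hb]
  have hobs0 : 0 ≤ ∑ x, ∑ t, (if e t x then (1 : ℝ) else 0) :=
    Finset.sum_nonneg fun x _ => Finset.sum_nonneg fun t _ => by split_ifs <;> norm_num
  have hinfo : -∑ x, Real.log (observedWeight δ i e x) ≤ 2 * δ ^ 2 * ∑ x, pullCount p i x := by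
    rw [hlog]
    have h3 := mul_le_mul_of_nonneg_right (neg_log_one_sub_sq_le h0 h1) hobs0
    have h4 := mul_le_mul_of_nonneg_left hobs (sq_nonneg δ)
    linarith
  -- As `0 ≤ pullCount ≤ T`, the change of density costs at most `T |L - 1|`. Upon summation `hone`
  -- cancels `L - 1`, leaving the entropy term and `1/8` per array.
  have hpoint : ∀ x, observedWeight δ i e x * pullCount p i x ≤ pullCount p i x +
      T * (8 * (observedWeight δ i e x - 1 - Real.log (observedWeight δ i e x)) +
        (1 + observedWeight δ i e x) / 16) := by
    intro x
    have ha := mul_le_mul_of_nonneg_right (le_abs_self (observedWeight δ i e x - 1))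
      (pullCount_nonneg (p := p) i x)
    have hb := mul_le_mul_of_nonneg_left (pullCount_le (p := p) i x)
      (abs_nonneg (observedWeight δ i e x - 1))
    have hc := mul_le_mul_of_nonneg_right (abs_sub_one_le (hpos x)) (Nat.cast_nonneg (α := ℝ) T)
    linarith
  rw [hcount]
  refine (Finset.sum_le_sum fun x _ => hpoint x).trans ?_
  rw [Finset.sum_add_distrib, ← Finset.mul_sum]
  gcongr
  rw [Finset.sum_add_distrib, ← Finset.mul_sum, ← Finset.sum_div, Finset.sum_sub_distrib,
    Finset.sum_sub_distrib, Finset.sum_add_distrib, ← hone]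
  simp only [Finset.sum_const, Finset.card_univ, nsmul_eq_mul, mul_one]
  linarith

/-- Averaged over the biased arm, any way of pulling suffers a large regret. -/
lemma le_sum_sum_biasedWeight_mul_advantage (hK : 2 ≤ K) (h0 : 0 ≤ δ) (h1 : δ ≤ 1 / 2)
    (hδ : 144 * (δ ^ 2 * T) ≤ K) (hp : NonAnticipating p) :
    K * Fintype.card (Fin T → Fin K → Bool) * (δ * T / 4) ≤
      ∑ i, ∑ x, biasedWeight δ i x * (∑ t, bitSign (x t i) -
        (1 / 2) * ∑ t, (bitSign (x t (p t x).1) + bitSign (x t (p t x).2))) := by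
  simp only [sum_biasedWeight_mul_advantage hp]
  set N : ℝ := ((Fintype.card (Fin T → Fin K → Bool) : ℕ) : ℝ) with hN
  have hN0 : 0 ≤ N := Nat.cast_nonneg _
  have hT0 : (0 : ℝ) ≤ T := Nat.cast_nonneg _
  have hK2 : (2 : ℝ) ≤ K := by exact_mod_cast hK
  have htot : ∑ i, ∑ x, pullCount p i x = T * N := by
    rw [Finset.sum_comm]
    simp [sum_pullCount, hN, mul_comm]
  have hsum : ∑ i, ∑ x, biasedWeight δ i x * pullCount p i x ≤
      T * N + T * (16 * δ ^ 2 * (T * N) + K * (N / 8)) := by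
    refine (Finset.sum_le_sum fun i _ =>
      sum_biasedWeight_mul_pullCount_le h0 h1 hp i).trans (le_of_eq ?_)
    rw [Finset.sum_add_distrib, ← Finset.mul_sum, Finset.sum_add_distrib, ← Finset.mul_sum, htot]
    simp [hN]
  rw [← Finset.mul_sum, Finset.sum_sub_distrib]
  simp only [Finset.sum_const, Finset.card_univ, Fintype.card_fin, nsmul_eq_mul]
  have hTN : 0 ≤ T * N := mul_nonneg hT0 hN0
  have e1 := mul_le_mul_of_nonneg_left hδ hTN
  have e2 := mul_le_mul_of_nonneg_left hK2 hTN
  -- In units of `K T N`, the pulls amount to at most `1/2 + 1/9 + 1/8 < 3/4`: `1/2` from `K ≥ 2`,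
  -- `1/9 = 16/144` from `hδ`.
  have e3 : K * N * (T / 4) ≤
      K * (T * N) - ∑ i, ∑ x, biasedWeight δ i x * pullCount p i x := by
    have : 0 ≤ T * N * K := mul_nonneg hTN (by linarith)
    nlinarith
  have := mul_le_mul_of_nonneg_left e3 h0
  linarith

end Regret


/-! ### From the bandit protocol to bits; measurability and boundedness -/

/-- The rewards `0` and `1` read off from bits. -/
noncomputable def bitReward {K T : ℕ} (x : Fin T → Fin K → Bool) : RewardAssignment K T :=
  fun t i => if x t i then 1 else 0

lemma coe_bitReward {K T : ℕ} (x : Fin T → Fin K → Bool) (t : Fin T) (i : Fin K) :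
    (bitReward x t i : ℝ) = (1 + bitSign (x t i)) / 2 := by
  cases h : x t i <;> simp [bitReward, bitSign, h]

section Game

variable {K T : ℕ} {Ω : Type*} [MeasurableSpace Ω]

/-- The history depends only on the rewards of the arms that were pulled. -/
lemma history_congr (ψ : ℝ → ℝ) (A : Algorithm K Ω) (ω : Ω) {x y : RewardAssignment K T} :
    ∀ (t : ℕ) (ht : t ≤ T), (∀ r : Fin T, (r : ℕ) < t →
      y r (pull ψ A x ω r).1 = x r (pull ψ A x ω r).1 ∧
      y r (pull ψ A x ω r).2 = x r (pull ψ A x ω r).2) →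
    history ψ A y ω t ht = history ψ A x ω t ht
  | 0, _, _ => rfl
  | t + 1, ht, h => by
    have ih := history_congr ψ A ω t (Nat.le_of_succ_le ht)
      (fun r hr => h r (Nat.lt_succ_of_lt hr))
    obtain ⟨h1, h2⟩ := h ⟨t, ht⟩ (Nat.lt_succ_self t)
    simp only [pull] at h1 h2
    simp only [history, ih, h1, h2]

lemma nonAnticipating_pull (ψ : ℝ → ℝ) (A : Algorithm K Ω) (ω : Ω) :
    NonAnticipating (T := T) fun t x => pull ψ A (bitReward x) ω t where
  past t i x s hs := by
    simp only [pull]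
    rw [history_congr ψ A ω s s.isLt.le]
    intro r hr
    have : r ≠ t := by rintro rfl; exact absurd hr (not_lt.2 hs)
    simp [bitReward, flipBit_of_ne_round t i x this]
  unobserved t i x h1 h2 s := by
    simp only [pull]
    rw [history_congr ψ A ω s s.isLt.le]
    intro r _
    by_cases hr : r = t
    · subst hr
      simp [bitReward, flipBit_of_ne_arm r i x r h1, flipBit_of_ne_arm r i x r h2]
    · simp [bitReward, flipBit_of_ne_round t i x hr]

lemma measurable_reward_comp {α : Type*} [MeasurableSpace α] {x : α → RewardAssignment K T}
    {a : α → Fin K} (hx : Measurable x) (ha : Measurable a) (t : Fin T) :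
    Measurable fun p => (x p t (a p) : ℝ) := by
  have h : Measurable fun q : (Fin K → unitInterval) × Fin K => q.1 q.2 :=
    measurable_from_prod_countable_left fun i => measurable_pi_apply i
  exact measurable_subtype_coe.comp (h.comp (((measurable_pi_apply t).comp hx).prodMk ha))

lemma measurable_history {ψ : ℝ → ℝ} (hψ : Measurable ψ) (A : Algorithm K Ω) :
    ∀ (t : ℕ) (ht : t ≤ T),
      Measurable fun p : RewardAssignment K T × Ω => history ψ A p.1 p.2 t ht
  | 0, _ => measurable_const
  | t + 1, ht => by
    have ih := measurable_history hψ A t (Nat.le_of_succ_le ht)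
    have hact : Measurable fun p : RewardAssignment K T × Ω =>
        A.act t p.2 (history ψ A p.1 p.2 t (Nat.le_of_succ_le ht)) :=
      (A.measurable_act t).comp (measurable_snd.prodMk ih)
    refine measurable_pi_lambda _ fun s => ?_
    refine Fin.lastCases ?_ (fun s => ?_) s
    · simp only [history, Fin.snoc_last]
      exact hact.prodMk (hψ.comp ((measurable_reward_comp measurable_fst hact.fst _).sub
        (measurable_reward_comp measurable_fst hact.snd _)))
    · simp only [history, Fin.snoc_castSucc]
      exact (measurable_pi_apply s).comp ih

lemma measurable_pull {ψ : ℝ → ℝ} (hψ : Measurable ψ) (A : Algorithm K Ω) (t : Fin T) :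
    Measurable fun p : RewardAssignment K T × Ω => pull ψ A p.1 p.2 t :=
  (A.measurable_act t).comp (measurable_snd.prodMk (measurable_history hψ A t t.isLt.le))

lemma measurable_regret {ψ : ℝ → ℝ} (hψ : Measurable ψ) (A : Algorithm K Ω) :
    Measurable fun p : RewardAssignment K T × Ω => maxGain p.1 - algGain ψ A p.1 p.2 := by
  refine Measurable.sub ?_ ?_
  · exact Measurable.iSup fun i => Finset.measurable_sum _ fun t _ =>
      measurable_reward_comp measurable_fst measurable_const t
  · exact (Finset.measurable_sum _ fun t _ =>
      (measurable_reward_comp measurable_fst (measurable_pull hψ A t).fst t).add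
        (measurable_reward_comp measurable_fst (measurable_pull hψ A t).snd t)).const_mul _

lemma sum_reward_le_maxGain (x : RewardAssignment K T) (i : Fin K) :
    ∑ t, (x t i : ℝ) ≤ maxGain x :=
  le_ciSup (f := fun i => ∑ t, (x t i : ℝ)) (Set.finite_range _).bddAbove i

lemma abs_regret_le (ψ : ℝ → ℝ) (A : Algorithm K Ω) (x : RewardAssignment K T) (ω : Ω) :
    |maxGain x - algGain ψ A x ω| ≤ T := by
  have hmax0 : 0 ≤ maxGain x := Real.iSup_nonneg fun i =>
    Finset.sum_nonneg fun t _ => (x t i).2.1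
  have hmax1 : maxGain x ≤ T := Real.iSup_le (fun i => by
    simpa using Finset.sum_le_sum fun t (_ : t ∈ Finset.univ) => (x t i).2.2)
    (Nat.cast_nonneg T)
  have hs0 : 0 ≤ ∑ t : Fin T, ((x t (pull ψ A x ω t).1 : ℝ) + (x t (pull ψ A x ω t).2 : ℝ)) :=
    Finset.sum_nonneg fun t _ => add_nonneg (x t _).2.1 (x t _).2.1
  have hs1 : ∑ t : Fin T, ((x t (pull ψ A x ω t).1 : ℝ) + (x t (pull ψ A x ω t).2 : ℝ)) ≤
      T + T := by
    simpa using Finset.sum_le_sum fun t (_ : t ∈ Finset.univ) =>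
      add_le_add (x t (pull ψ A x ω t).1).2.2 (x t (pull ψ A x ω t).2).2.2
  rw [abs_le, algGain]
  constructor <;> linarith

end Game

/-! ### The hidden-arm distribution and its expected regret -/

/-- Fair independent `0`-`1` rewards, except that those of one arm, drawn uniformly at random, have
mean `(1 + δ) / 2`. -/
noncomputable def hiddenArmMeasure (K T : ℕ) (δ : ℝ) : Measure (RewardAssignment K T) :=
  ∑ i : Fin K, ∑ x : Fin T → Fin K → Bool,
    ENNReal.ofReal (biasedWeight δ i x / (K * Fintype.card (Fin T → Fin K → Bool))) •
      Measure.dirac (bitReward x)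

section HiddenArm

variable {K T : ℕ} {δ : ℝ}

lemma hiddenArmMeasure_weight_nonneg (h0 : 0 ≤ δ) (h1 : δ < 1) (i : Fin K)
    (x : Fin T → Fin K → Bool) :
    0 ≤ biasedWeight δ i x / (K * Fintype.card (Fin T → Fin K → Bool)) :=
  div_nonneg (biasedWeight_nonneg h0 h1 x) (by positivity)

lemma isProbabilityMeasure_hiddenArmMeasure (hK : K ≠ 0) (h0 : 0 ≤ δ) (h1 : δ < 1) :
    IsProbabilityMeasure (hiddenArmMeasure K T δ) := by
  have hN : ((Fintype.card (Fin T → Fin K → Bool) : ℕ) : ℝ) ≠ 0 :=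
    Nat.cast_ne_zero.2 Fintype.card_ne_zero
  have hK' : (K : ℝ) ≠ 0 := Nat.cast_ne_zero.2 hK
  have hw := fun i x => hiddenArmMeasure_weight_nonneg (K := K) (T := T) h0 h1 i x
  constructor
  simp only [hiddenArmMeasure, Measure.coe_finsetSum, Finset.sum_apply, Measure.smul_apply,
    measure_univ, smul_eq_mul, mul_one]
  simp only [← ENNReal.ofReal_sum_of_nonneg fun x _ => hw _ x]
  rw [← ENNReal.ofReal_sum_of_nonneg fun i _ => Finset.sum_nonneg fun x _ => hw i x]
  simp only [← Finset.sum_div, sum_biasedWeight, Finset.sum_const, Finset.card_univ,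
    Fintype.card_fin, nsmul_eq_mul]
  rw [div_self (mul_ne_zero hK' hN), ENNReal.ofReal_one]

lemma integral_hiddenArmMeasure (h0 : 0 ≤ δ) (h1 : δ < 1) (g : RewardAssignment K T → ℝ) :
    ∫ x, g x ∂hiddenArmMeasure K T δ = ∑ i, ∑ x, biasedWeight δ i x * g (bitReward x) /
      (K * Fintype.card (Fin T → Fin K → Bool)) := by
  have hint : ∀ (i : Fin K) (x : Fin T → Fin K → Bool), Integrable g
      (ENNReal.ofReal (biasedWeight δ i x / (K * Fintype.card (Fin T → Fin K → Bool))) •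
        Measure.dirac (bitReward x)) := fun i x =>
    (integrable_dirac enorm_lt_top).smul_measure ENNReal.ofReal_ne_top
  rw [hiddenArmMeasure, integral_finsetSum_measure fun i _ =>
    integrable_finsetSum_measure.2 fun x _ => hint i x]
  refine Finset.sum_congr rfl fun i _ => ?_
  rw [integral_finsetSum_measure fun x _ => hint i x]
  refine Finset.sum_congr rfl fun x _ => ?_
  rw [integral_smul_measure, integral_dirac,
    ENNReal.toReal_ofReal (hiddenArmMeasure_weight_nonneg h0 h1 i x), smul_eq_mul]
  ring

lemma le_integral_regret {Ω : Type*} [MeasurableSpace Ω] (hK : 2 ≤ K) (h0 : 0 ≤ δ)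
    (h1 : δ ≤ 1 / 2) (hδ : 144 * (δ ^ 2 * T) ≤ K) (ψ : ℝ → ℝ) (A : Algorithm K Ω) (ω : Ω) :
    δ * T / 8 ≤ ∫ x, (maxGain x - algGain ψ A x ω) ∂hiddenArmMeasure K T δ := by
  rw [integral_hiddenArmMeasure h0 (by linarith)]
  simp only [← Finset.sum_div]
  have hN : (0 : ℝ) < ((Fintype.card (Fin T → Fin K → Bool) : ℕ) : ℝ) :=
    Nat.cast_pos.2 Fintype.card_pos
  have hK' : (0 : ℝ) < K := Nat.cast_pos.2 (by omega)
  rw [le_div_iff₀ (mul_pos hK' hN)]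
  have hmain := le_sum_sum_biasedWeight_mul_advantage hK h0 h1 hδ
    (nonAnticipating_pull (T := T) ψ A ω)
  -- The best arm is at least as good as the biased one; passing from signs to rewards halves the
  -- advantage.
  have hle : ∀ (i : Fin K) (x : Fin T → Fin K → Bool),
      (∑ t, bitSign (x t i) - (1 / 2) * ∑ t, (bitSign (x t (pull ψ A (bitReward x) ω t).1) +
        bitSign (x t (pull ψ A (bitReward x) ω t).2))) / 2 ≤
      maxGain (bitReward x) - algGain ψ A (bitReward x) ω := by
    intro i x
    have h := sum_reward_le_maxGain (bitReward x) i
    simp only [algGain, coe_bitReward, ← Finset.sum_div, Finset.sum_add_distrib] at h ⊢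
    linarith
  have hsum : (∑ i, ∑ x : Fin T → Fin K → Bool, biasedWeight δ i x * (∑ t, bitSign (x t i) -
      (1 / 2) * ∑ t, (bitSign (x t (pull ψ A (bitReward x) ω t).1) +
        bitSign (x t (pull ψ A (bitReward x) ω t).2)))) / 2 ≤
      ∑ i, ∑ x : Fin T → Fin K → Bool,
        biasedWeight δ i x * (maxGain (bitReward x) - algGain ψ A (bitReward x) ω) := by
    simp only [Finset.sum_div, mul_div_assoc]
    exact Finset.sum_le_sum fun i _ => Finset.sum_le_sum fun x _ =>
      mul_le_mul_of_nonneg_left (hle i x) (biasedWeight_nonneg h0 (by linarith) x)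
  linarith

lemma le_expectedRegret {Ω : Type*} [MeasurableSpace Ω] (hK : 2 ≤ K) (h0 : 0 ≤ δ)
    (h1 : δ ≤ 1 / 2) (hδ : 144 * (δ ^ 2 * T) ≤ K) {ψ : ℝ → ℝ} (hψ : Measurable ψ)
    (μ : Measure Ω) [IsProbabilityMeasure μ] (A : Algorithm K Ω) :
    δ * T / 8 ≤ expectedRegret ψ A μ (hiddenArmMeasure K T δ) := by
  have := isProbabilityMeasure_hiddenArmMeasure (K := K) (T := T) (by omega) h0
    (by linarith : δ < 1)
  have hint : Integrable (fun p : RewardAssignment K T × Ω =>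
      maxGain p.1 - algGain ψ A p.1 p.2) ((hiddenArmMeasure K T δ).prod μ) :=
    .of_bound (measurable_regret hψ A).aestronglyMeasurable T
      (.of_forall fun p => abs_regret_le ψ A p.1 p.2)
  -- The seed becomes the outer variable, so the bound for each fixed seed can be averaged.
  rw [expectedRegret, integral_prod_symm _ hint]
  calc δ * T / 8 = ∫ _, δ * T / 8 ∂μ := by simp
    _ ≤ _ := integral_mono (integrable_const _) hint.integral_prod_right
      fun ω => le_integral_regret hK h0 h1 hδ ψ A ω

end HiddenArm

end DuelingBandit

/-! ### Choice of the bias -/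

theorem theorem4 :
    ∃ c : ℝ, 0 < c ∧
      ∀ K T : ℕ, 2 ≤ K → Real.sqrt ((K : ℝ) * (T : ℝ)) ≤ (T : ℝ) →
        ∃ D : Measure (DuelingBandit.RewardAssignment K T), IsProbabilityMeasure D ∧
          ∀ ψ : ℝ → ℝ, Monotone ψ → ψ 0 = 0 →
            ∀ (Ω : Type u) [MeasurableSpace Ω] (μ : Measure Ω) [IsProbabilityMeasure μ]
              (A : DuelingBandit.Algorithm K Ω),
              c * Real.sqrt ((K : ℝ) * (T : ℝ)) ≤ DuelingBandit.expectedRegret ψ A μ D := by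
  -- `96 = 8 * 12`: the regret is at least `δ T / 8`, and `δ T = √(K T) / 12`.
  refine ⟨1 / 96, by norm_num, fun K T hK hKT => ?_⟩
  have hT0 : (0 : ℝ) ≤ T := Nat.cast_nonneg T
  have hK0 : (0 : ℝ) ≤ K := Nat.cast_nonneg K
  set δ : ℝ := √(K * T) / T / 12 with hδ
  have h0 : 0 ≤ δ := by positivity
  have h1 : δ ≤ 1 / 12 := by
    have := div_le_one_of_le₀ hKT hT0
    rw [hδ]
    linarith
  have hδT : δ * T = √(K * T) / 12 := by
    -- `T = 0` is allowed; division by zero then makes `δ = 0`.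
    rcases hT0.eq_or_lt with h | h
    · simp [← h]
    · rw [hδ]
      field_simp
  have hsq : 144 * (δ ^ 2 * T) ≤ K := by
    rcases hT0.eq_or_lt with h | h
    · simp [← h, hK0]
    · have hs := Real.sq_sqrt (mul_nonneg hK0 hT0)
      refine le_of_mul_le_mul_right ?_ h
      calc 144 * (δ ^ 2 * T) * T = 144 * (δ * T) ^ 2 := by ring
        _ = √(K * T) ^ 2 := by rw [hδT]; ring
        _ ≤ K * T := hs.le
  refine ⟨DuelingBandit.hiddenArmMeasure K T δ,
    DuelingBandit.isProbabilityMeasure_hiddenArmMeasure (by omega) h0 (by linarith), ?_⟩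
  intro ψ hψ _ Ω _ μ _ A
  have := DuelingBandit.le_expectedRegret hK h0 (by linarith) hsq hψ.measurable μ A
  linarith
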